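/- **Setting.** Write $|\cdot|$ for the Euclidean norm, $B(R)$ and $B(x;R)$ for the closed balls of radius $R$ in $\mathbb{R}^n$ with center $0$ and $x$. Let $D\subset\mathbb{R}^n$ be a domain (nonempty, open, connected) and let agents $i\in\mathcal N=\{1,\dots,N\}$, each with a finite set of neighbors $\mathcal N_i\subset\mathcal N\setminus\{i\}$ of cardinality $N_i$, obey $$\dot x_i=f_i(x_i,\mathbf x_j)+v_i,\qquad x_i\in D,\ i\in\mathcal N,$$ where $\mathbf x_j\in D^{N_i}$ is the tuple of states of the neighbors of $i$. Let $M>v_{\max}>0$ and $L_1,L_2>0$ be such that on $D$: $|f_i(x_i,\mathbf x_j)|\le M$, $|f_i(x_i,\mathbf x_j)-f_i(x_i,\mathbf y_j)|\le L_1|\mathbf x_j-\mathbf y_j|$ and $|f_i(x_i,\mathbf x_j)-f_i(y_i,\mathbf x_j)|\le L_2|x_i-y_i|$. Assume invariance: for every $x(0)\in D^N$ and all piecewise continuous $v_i:[0,\infty)\to\mathbb{R}^n$ with $|v_i(t)|\le v_{\max}$, the solution exists and remains in $D^N$ for all $t\ge 0$. A *cell decomposition* of $D$ is a finite or countable family $\mathcal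 S=\{S_l\}_{l\in\mathcal I}$ of nonempty connected sets with $\bigcup_l S_l=D$, $d_{\max}:=\sup_l\operatorname{diam}(S_l)<\infty$, $\operatorname{cl}(\operatorname{int}(S_l))=S_l$ (closure in $D$), and pairwise disjoint interiors. A cell configuration of $i$ is $\mathbf l_i=(l_i,(l_j)_{j\in\mathcal N_i})\in\mathcal I^{N_i+1}$; a configuration $\mathbf l\in\mathcal I^N$ of all agents projects to $\mathrm{pr}_i(\mathbf l)=(l_i,(l_j)_{j\in\mathcal N_i})$. Fix a time step $\delta t>0$ and a nonempty $W\subset\mathbb{R}^n$, and put $R_{\max}:=\delta t(M+v_{\max})$. *Property (P).* A feedback law of agent $i$ for $\mathbf l_i$ is a family of maps $k_{i,\mathbf l_i}(\cdot;x_{i0},w_i):[0,T(x_{i0},w_i))\times D^{N_i+1}\to\mathbb{R}^n$, with $0<T(x_{i0},w_i)\le\infty$, $x_{i0}\in S_{l_i}$, $w_i\in W$. It satisfies (P) if, for all $x_{i0}\in S_{l_i}$, $w_i\in W$: (P1) $k_{i,\mathbf l_i}(\cdot;x_{i0},w_i)$ is locally Lipschitz; (P2) $|k_{i,\mathbf l_i}(t,x_i,\mathbf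 x_j;x_{i0},w_i)|\le v_{\max}$ for $t\in[0,\delta t]\cap[0,T(x_{i0},w_i))$, $x_i\in(S_{l_i}+B(R_{\max}))\cap D$ and $x_j\in(S_{l_j}+B(R_{\max}))\cap D$, $j\in\mathcal N_i$; (P3) $T(x_{i0},w_i)>\delta t$. *Well-posed transitions.* The transition $l_i\overset{\mathbf l_i}{\longrightarrow}l_i'$ is well posed if there are a feedback law $k_{i,\mathbf l_i}$ with (P) and a vector $w_i\in W$ such that for every $\mathbf l\in\mathcal I^N$ with $\mathrm{pr}_i(\mathbf l)=\mathbf l_i$, all feedback laws $k_{\ell,\mathrm{pr}_\ell(\mathbf l)}$ of the agents $\ell\ne i$ with (P), all $w_\ell\in W$ ($\ell\neq i$) and all $x(0)$ with $x_m(0)=x_{m0}\in S_{l_m}$ ($m\in\mathcal N$), the closed-loop system with $v_m=k_{m,\mathrm{pr}_m(\mathbf l)}(t,x_m,\mathbf x_{j};x_{m0},w_m)$, $m\in\mathcal N$, has a solution in $D^N$ on $[0,\delta t]$, and its solution satisfies $x_i(\delta t)\in S_{l_i'}$. $\mathrm{Post}_i(l_i;\mathbf l_i)$ denotes the set of all $l_i'\in\mathcal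 I$ such that $l_i\overset{\mathbf l_i}{\longrightarrow}l_i'$ is well posed. The space-time discretization $\mathcal S$-$\delta t$ is well posed if $\mathrm{Post}_i(l_i;\mathbf l_i)\ne\emptyset$ for each agent $i$ and cell configuration $\mathbf l_i$. *Restrictions.* Let $\lambda\in(0,1)$, $\mu>0$, $W:=B(\lambda v_{\max})$, $r:=\lambda v_{\max}\delta t$, $L:=\max_{i}(3L_2+4L_1\sqrt{N_i})$, and $$\bar d:=\tfrac{(1-\lambda)^2v_{\max}^2}{4ML},\quad \bar d_\mu:=\tfrac{2(\lambda(1-\lambda)\mu-2\lambda^2)v_{\max}^2}{\mu^2ML},\quad h_\pm:=\tfrac{(1-\lambda)v_{\max}\pm\sqrt{(1-\lambda)^2v_{\max}^2-4MLd_{\max}}}{2ML}.$$ Assume that one of the following holds. - Case I: $0\le\mu\le\frac{2\lambda}{1-\lambda}$, $d_{\max}\in(0,\bar d]$, $\delta t\in[h_-,h_+]$. - Case II: $\frac{2\lambda}{1-\lambda}<\mu<\frac{4\lambda}{1-\lambda}$, and either $d_{\max}\in(0,\bar d_\mu]$, $\delta t\in[\frac{\mu}{2\lambda v_{\max}}d_{\max},h_+]$,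 or $d_{\max}\in(\bar d_\mu,\bar d]$, $\delta t\in[h_-,h_+]$. - Case III: $\mu\ge\frac{4\lambda}{1-\lambda}$, $d_{\max}\in(0,\bar d_\mu]$, $\delta t\in[\frac{\mu}{2\lambda v_{\max}}d_{\max},h_+]$. **Theorem.** Then for each agent $i$ and each cell configuration $\mathbf l_i$ of $i$ we have $\mathrm{Post}_i(l_i;\mathbf l_i)\neq\emptyset$, that is, the space-time discretization $\mathcal S$-$\delta t$ is well posed. Moreover, for any reference points $x_{i,G}\in S_{l_i}$ and $\mathbf x_{j,G}\in\prod_{j\in\mathcal N_i}S_{l_j}$, the solution $\chi_i$ of $\dot\chi_i=f_i(\chi_i,\mathbf x_{j,G})$, $\chi_i(0)=x_{i,G}$, is defined and remains in $D$ on $[0,\delta t]$, and $$B(\chi_i(\delta t);r)\subset D,\qquad \mathrm{Post}_i(l_i;\mathbf l_i)\supset\{l\in\mathcal I:\ S_l\cap B(\chi_i(\delta t);r)\ne\emptyset\}.$$ -/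

import Mathlib

open Set Filter Topology
open scoped Pointwise

/-- The state space `ℝⁿ` with the Euclidean norm. -/
abbrev Space (n : ℕ) : Type := EuclideanSpace ℝ (Fin n)

/-- A multi-agent system `ẋᵢ = fᵢ(xᵢ, 𝐱ⱼ) + vᵢ` with `N` agents in a domain `D ⊆ ℝⁿ`.
The tuple `𝐱ⱼ` of the states of the neighbors of `i` is indexed by the finite set `nbr i` of
neighbors itself. Only the values of `f i` on `D × D^{Nᵢ}` play a role. -/
structure MultiAgentSystem (N n : ℕ) where
  D : Set (Space n)
  isOpen_D : IsOpen D
  isConnected_D : IsConnected D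
  /-- the neighbors of an agent -/
  nbr : Fin N → Finset (Fin N)
  not_mem_nbr : ∀ i, i ∉ nbr i
  /-- the feedback terms -/
  f : (i : Fin N) → Space n → (nbr i → Space n) → Space n
  /-- bound on the feedback terms -/
  M : ℝ
  /-- bound on the free inputs -/
  vmax : ℝ
  /-- Lipschitz constant with respect to the states of the neighbors -/
  L₁ : ℝ
  /-- Lipschitz constant with respect to the agent's own state -/
  L₂ : ℝ
  M_pos : 0 < M
  vmax_pos : 0 < vmax
  vmax_lt_M : vmax < M
  L₁_pos : 0 < L₁
  L₂_pos : 0 < L₂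
  norm_f_le : ∀ i, ∀ x ∈ D, ∀ y : nbr i → Space n, (∀ j, y j ∈ D) → ‖f i x y‖ ≤ M
  lipschitz_nbr : ∀ i, ∀ x ∈ D, ∀ y z : nbr i → Space n, (∀ j, y j ∈ D) → (∀ j, z j ∈ D) →
    ‖f i x y - f i x z‖ ≤ L₁ * √(∑ j, ‖y j - z j‖ ^ 2)
  lipschitz_own : ∀ i, ∀ x ∈ D, ∀ x' ∈ D, ∀ y : nbr i → Space n, (∀ j, y j ∈ D) →
    ‖f i x y - f i x' y‖ ≤ L₂ * ‖x - x'‖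

/-- Piecewise continuity on `[0, ∞)`: finitely many discontinuities on every interval `[0, T]`,
and finite one-sided limits everywhere. -/
def PiecewiseContinuous {E : Type*} [TopologicalSpace E] (v : ℝ → E) : Prop :=
  (∀ T : ℝ, {t ∈ Icc 0 T | ¬ ContinuousWithinAt v (Ici 0) t}.Finite) ∧
  (∀ t : ℝ, 0 ≤ t → ∃ a, Tendsto v (𝓝[>] t) (𝓝 a)) ∧
  (∀ t : ℝ, 0 < t → ∃ a, Tendsto v (𝓝[<] t) (𝓝 a))

/-- A cell decomposition `{S l}` of `D`. The index type is required to be countable where this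
is used. The closure in `closure_interior` is the closure in `D`; for sets that are closed in
`ℝⁿ` the condition reads `closure (interior (S l)) = S l`. -/
structure IsCellDecomposition {n : ℕ} {I : Type*} (D : Set (Space n)) (S : I → Set (Space n)) :
    Prop where
  isConnected : ∀ l, IsConnected (S l)
  diam_bounded : ∃ C : ℝ, ∀ l, ∀ x ∈ S l, ∀ y ∈ S l, dist x y ≤ C
  closure_interior : ∀ l, closure (interior (S l)) ∩ D = S l
  interior_disjoint : ∀ l l', l ≠ l' → interior (S l) ∩ interior (S l') = ∅
  iUnion_eq : ⋃ l, S l = D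

/-- The diameter `d_max` of a cell decomposition: the supremum of the diameters of the cells. -/
noncomputable def cellDiameter {n : ℕ} {I : Type*} (S : I → Set (Space n)) : ℝ :=
  ⨆ l, Metric.diam (S l)

/-- A transition system with states `Q`, actions `Act` and a transition relation. -/
structure TransitionSystem (Q Act : Type*) where
  trans : Q → Act → Q → Prop

/-- The successors of the state `q` under the action `a`. -/
def TransitionSystem.Post {Q Act : Type*} (TS : TransitionSystem Q Act) (q : Q) (a : Act) :
    Set Q :=
  {q' | TS.trans q a q'}

namespace MultiAgentSystem

variable {N n : ℕ} (sys : MultiAgentSystem N n) {I : Type*}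

/-- `x` solves the system with free input `v` on `[0, ∞)` (in integrated form) and remains
in `D^N`. -/
def IsOpenLoopSolution (v x : Fin N → ℝ → Space n) : Prop :=
  (∀ i, ContinuousOn (x i) (Ici 0)) ∧
  (∀ i, ∀ t : ℝ, 0 ≤ t → x i t ∈ sys.D) ∧
  ∀ i, ∀ t : ℝ, 0 ≤ t →
    x i t = x i 0 + ∫ s in (0 : ℝ)..t, (sys.f i (x i s) (fun j => x j s) + v i s)

/-- The Invariance Assumption (IA): for every initial condition in `D^N` and every piecewise
continuous free input bounded by `vmax`, the solution exists and remains in `D^N` for all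
`t ≥ 0`. -/
def InvarianceAssumption : Prop :=
  ∀ x₀ : Fin N → Space n, (∀ i, x₀ i ∈ sys.D) →
    ∀ v : Fin N → ℝ → Space n, (∀ i, PiecewiseContinuous (v i)) →
      (∀ i, ∀ t : ℝ, 0 ≤ t → ‖v i t‖ ≤ sys.vmax) →
      ∃ x : Fin N → ℝ → Space n, (∀ i, x i 0 = x₀ i) ∧ sys.IsOpenLoopSolution v x

/-- Cell configurations of agent `i`: the indices of the cells of `i` and of its neighbors. -/
abbrev CellConfig (I : Type*) (i : Fin N) : Type _ := I × (sys.nbr i → I)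

/-- The projection `pr_i` of a cell configuration of all agents to one of agent `i`. -/
def pr (i : Fin N) (l : Fin N → I) : sys.CellConfig I i := (l i, fun j => l j)

/-- The distance `R_max = δt (M + vmax)`. -/
def Rmax (δt : ℝ) : ℝ := δt * (sys.M + sys.vmax)

/-- The data of a feedback law of agent `i`, parameterized by `x_{i0}` and `w_i`: a time
`T(x_{i0}, w_i)`, possibly infinite, and a map `k(t, x_i, 𝐱_j; x_{i0}, w_i)`, of which only the
values for `t ∈ [0, T(x_{i0}, w_i))` and states in `D` play a role. -/
structure FeedbackLaw (i : Fin N) where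
  T : Space n → Space n → EReal
  k : Space n → Space n → ℝ → Space n → (sys.nbr i → Space n) → Space n

/-- Property (P) of a feedback law of agent `i` for the cell configuration `l` of `i`. -/
structure PropertyP (S : I → Set (Space n)) (δt : ℝ) (W : Set (Space n)) (i : Fin N)
    (l : sys.CellConfig I i) (K : sys.FeedbackLaw i) : Prop where
  P1 : ∀ x₀ ∈ S l.1, ∀ w ∈ W,
    LocallyLipschitzOn
      {p : ℝ × Space n × (sys.nbr i → Space n) |
        0 ≤ p.1 ∧ (p.1 : EReal) < K.T x₀ w ∧ p.2.1 ∈ sys.D ∧ ∀ j, p.2.2 j ∈ sys.D}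
      (fun p => K.k x₀ w p.1 p.2.1 p.2.2)
  P2 : ∀ x₀ ∈ S l.1, ∀ w ∈ W, ∀ t ∈ Icc 0 δt, (t : EReal) < K.T x₀ w →
    ∀ x ∈ (S l.1 + Metric.closedBall 0 (sys.Rmax δt)) ∩ sys.D,
    ∀ y : sys.nbr i → Space n,
      (∀ j, y j ∈ (S (l.2 j) + Metric.closedBall 0 (sys.Rmax δt)) ∩ sys.D) →
      ‖K.k x₀ w t x y‖ ≤ sys.vmax
  P3 : ∀ x₀ ∈ S l.1, ∀ w ∈ W, (δt : EReal) < K.T x₀ w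

/-- `x` is, on `[0, δt]`, a solution in `D^N` of the closed-loop system in which every agent `m`
uses the feedback law `K m` with parameters `x₀ m` and `w m`, and which starts from `x₀`. -/
def IsClosedLoopSolution (δt : ℝ) (K : (m : Fin N) → sys.FeedbackLaw m)
    (w x₀ : Fin N → Space n) (x : Fin N → ℝ → Space n) : Prop :=
  ∀ m, x m 0 = x₀ m ∧ ∀ t ∈ Icc 0 δt,
    x m t ∈ sys.D ∧ (t : EReal) < (K m).T (x₀ m) (w m) ∧
    HasDerivWithinAt (x m)
      (sys.f m (x m t) (fun j => x j t) + (K m).k (x₀ m) (w m) t (x m t) (fun j => x j t))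
      (Icc 0 δt) t

/-- Condition (C) for the cell configuration `li` of agent `i`, its feedback law `Ki`, the vector
`wi` and the target cell `l'`. -/
def ConditionC (S : I → Set (Space n)) (δt : ℝ) (W : Set (Space n)) (i : Fin N)
    (li : sys.CellConfig I i) (Ki : sys.FeedbackLaw i) (wi : Space n) (l' : I) : Prop :=
  ∀ l : Fin N → I, sys.pr i l = li →
  ∀ K : (m : Fin N) → sys.FeedbackLaw m, K i = Ki →
    (∀ m, m ≠ i → sys.PropertyP S δt W m (sys.pr m l) (K m)) →
  ∀ w : Fin N → Space n, w i = wi → (∀ m, m ≠ i → w m ∈ W) →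
  ∀ x₀ : Fin N → Space n, (∀ m, x₀ m ∈ S (l m)) →
    (∃ x, sys.IsClosedLoopSolution δt K w x₀ x) ∧
    ∀ x, sys.IsClosedLoopSolution δt K w x₀ x → x i δt ∈ S l'

/-- The transition of agent `i` from its cell in the configuration `li` to the cell `l'` is well
posed with respect to the space-time discretization. -/
def WellPosedTransition (S : I → Set (Space n)) (δt : ℝ) (W : Set (Space n)) (i : Fin N)
    (li : sys.CellConfig I i) (l' : I) : Prop :=
  ∃ Ki : sys.FeedbackLaw i, sys.PropertyP S δt W i li Ki ∧
    ∃ wi ∈ W, sys.ConditionC S δt W i li Ki wi l'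

/-- The space-time discretization is well posed. -/
def WellPosedDiscretization (S : I → Set (Space n)) (δt : ℝ) (W : Set (Space n)) : Prop :=
  ∀ (i : Fin N) (li : sys.CellConfig I i), ∃ l' : I, sys.WellPosedTransition S δt W i li l'

/-- The individual transition system of agent `i`. An action, i.e. a cell configuration of `i`,
is only enabled in the state that is its first component. -/
def individualTS (S : I → Set (Space n)) (δt : ℝ) (W : Set (Space n)) (i : Fin N) :
    TransitionSystem I (sys.CellConfig I i) where
  trans q li l' := q = li.1 ∧ sys.WellPosedTransition S δt W i li l'

/-- `χ` solves `χ' = f_i(χ, 𝐱_{j,G})`, `χ(0) = x_{i,G}` on `[0, δt]` and remains in `D` there. -/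
def IsReferenceTrajectory (δt : ℝ) (i : Fin N) (xG : Space n) (yG : sys.nbr i → Space n)
    (χ : ℝ → Space n) : Prop :=
  χ 0 = xG ∧ ∀ t ∈ Icc 0 δt, χ t ∈ sys.D ∧
    HasDerivWithinAt χ (sys.f i (χ t) yG) (Icc 0 δt) t

/-- The constant `L = max_i (3 L₂ + 4 L₁ √N_i)`. -/
noncomputable def L : ℝ := ⨆ i : Fin N, (3 * sys.L₂ + 4 * sys.L₁ * √((sys.nbr i).card : ℝ))

end MultiAgentSystem

/-- The upper bound for `d` in Case I. -/
noncomputable def dBound (M vmax L lam : ℝ) : ℝ := (1 - lam) ^ 2 * vmax ^ 2 / (4 * M * L)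

/-- The upper bound for `d` that depends on `mu`. -/
noncomputable def dBoundMu (M vmax L lam mu : ℝ) : ℝ :=
  2 * (lam * (1 - lam) * mu - 2 * lam ^ 2) * vmax ^ 2 / (mu ^ 2 * M * L)

/-- The lower end of the interval for the time step in Case I. -/
noncomputable def lowerTime (M vmax L lam d : ℝ) : ℝ :=
  ((1 - lam) * vmax - √((1 - lam) ^ 2 * vmax ^ 2 - 4 * M * L * d)) / (2 * M * L)

/-- The upper end of the intervals for the time step. -/
noncomputable def upperTime (M vmax L lam d : ℝ) : ℝ :=
  ((1 - lam) * vmax + √((1 - lam) ^ 2 * vmax ^ 2 - 4 * M * L * d)) / (2 * M * L)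

/-- The restrictions on `lam`, `mu`, the diameter `d` and the time step `δt` (Cases I, II, III). -/
def AdmissibleParameters (M vmax L lam mu d δt : ℝ) : Prop :=
  -- Case I
  ((0 ≤ mu ∧ mu ≤ 2 * lam / (1 - lam)) ∧
    d ∈ Ioc 0 (dBound M vmax L lam) ∧
    δt ∈ Icc (lowerTime M vmax L lam d) (upperTime M vmax L lam d)) ∨
  -- Case II
  ((2 * lam / (1 - lam) < mu ∧ mu < 4 * lam / (1 - lam)) ∧
    ((d ∈ Ioc 0 (dBoundMu M vmax L lam mu) ∧
        δt ∈ Icc (mu / (2 * lam * vmax) * d) (upperTime M vmax L lam d)) ∨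
      (d ∈ Ioc (dBoundMu M vmax L lam mu) (dBound M vmax L lam) ∧
        δt ∈ Icc (lowerTime M vmax L lam d) (upperTime M vmax L lam d)))) ∨
  -- Case III
  (4 * lam / (1 - lam) ≤ mu ∧
    d ∈ Ioc 0 (dBoundMu M vmax L lam mu) ∧
    δt ∈ Icc (mu / (2 * lam * vmax) * d) (upperTime M vmax L lam d))

/-! All three cases of the restrictions imply one inequality, `M L δt² - (1-λ) vmax δt + d_max ≤ 0`.
Divided by `δt`, it is a budget: after `λ vmax` is reserved for `w`, the rest of the input pays for
the coupling mismatch and for correcting the initial offset at speed `d_max/δt`.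

Agent `i` uses the law `f_i(χ(t), 𝐱_G) - f_i(x_i, 𝐱_j) + (x_G - x_{i0})/δt + w`, saturated at
`vmax`. Without saturation it moves the agent along `χ(t) + (1 - t/δt)(x_{i0} - x_G) + t w`, which
ends at `χ(δt) + δt w` whatever the start and the other agents. This path is not known in advance to
stay in `D`, so the law is saturated first and compared afterwards: the budget bounds the saturation
error by `L₂` times the deviation from the path, and Grönwall makes the deviation vanish
(`exists_tracking_law`). As `w` ranges over `W`, the endpoints fill the ball of radius `r`.

Invariance concerns open-loop inputs, whereas feedback laws are only locally Lipschitz on `D`. The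
bridge is `ball_subset_of_solution`: the distance to the complement of `D` shrinks at most
exponentially, at a rate independent of the input. This confines solutions to a compact set fixed
beforehand, and `exists_closedLoopSolution` follows. Reference trajectories and points of the ball
lie in `D` because closed-loop solutions realize them. -/

/-! ### Radial saturation and bounded Lipschitz extension -/

section Saturation

variable {E : Type*} [NormedAddCommGroup E] [NormedSpace ℝ E]

/-- The radial retraction onto the closed ball of radius `c`. -/
noncomputable def saturate (c : ℝ) (v : E) : E := (c / max c ‖v‖) • v

theorem norm_saturate_le {c : ℝ} (hc : 0 < c) (v : E) : ‖saturate c v‖ ≤ c := by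
  have h0 : 0 < max c ‖v‖ := lt_max_of_lt_left hc
  rw [saturate, norm_smul, Real.norm_of_nonneg (by positivity), div_mul_eq_mul_div,
    div_le_iff₀ h0]
  exact mul_le_mul_of_nonneg_left (le_max_right _ _) hc.le

theorem saturate_of_norm_le {c : ℝ} (hc : 0 < c) {v : E} (hv : ‖v‖ ≤ c) : saturate c v = v := by
  rw [saturate, max_eq_left hv, div_self hc.ne', one_smul]

/-- Outside the ball the retraction shortens `v` by exactly `‖v‖ - c`. In the tracking argument `b`
is `L₂` times the deviation. -/
theorem norm_saturate_sub_le {c b : ℝ} (hc : 0 < c) (hb : 0 ≤ b) {v : E} (hv : ‖v‖ ≤ c + b) :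
    ‖saturate c v - v‖ ≤ b := by
  rcases le_total ‖v‖ c with h | h
  · simpa [saturate_of_norm_le hc h] using hb
  · have hv0 : 0 < ‖v‖ := hc.trans_le h
    have : saturate c v - v = -((1 - c / ‖v‖) • v) := by
      rw [saturate, max_eq_right h, sub_smul, one_smul, neg_sub]
    rw [this, norm_neg, norm_smul,
      Real.norm_of_nonneg (sub_nonneg.2 ((div_le_one hv0).2 h)), sub_mul,
      div_mul_cancel₀ _ hv0.ne']
    linarith

/-- The difference splits into a factor at most 1 times `u - v`, and the change of the factor times
`v`, where the denominator `max c ‖v‖` absorbs `‖v‖`. Each part contributes 1 in any normed space.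
-/
theorem lipschitzWith_saturate {c : ℝ} (hc : 0 < c) :
    LipschitzWith 2 (saturate c : E → E) := by
  refine LipschitzWith.of_dist_le_mul fun u v => ?_
  rw [dist_eq_norm, dist_eq_norm]
  have hu : 0 < max c ‖u‖ := lt_max_of_lt_left hc
  have hv : 0 < max c ‖v‖ := lt_max_of_lt_left hc
  have key : saturate c u - saturate c v =
      (c / max c ‖u‖) • (u - v) + (c / max c ‖u‖ - c / max c ‖v‖) • v := by
    simp only [saturate, smul_sub, sub_smul]; abel
  have h1 : ‖(c / max c ‖u‖) • (u - v)‖ ≤ ‖u - v‖ := by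
    rw [norm_smul, Real.norm_of_nonneg (by positivity)]
    exact mul_le_of_le_one_left (norm_nonneg _) ((div_le_one hu).2 (le_max_left _ _))
  have h2 : ‖(c / max c ‖u‖ - c / max c ‖v‖) • v‖ ≤ ‖u - v‖ := by
    have hm : |max c ‖v‖ - max c ‖u‖| ≤ ‖u - v‖ := by
      rw [max_comm c, max_comm c, norm_sub_rev]
      refine (abs_max_sub_max_le_abs ‖v‖ ‖u‖ c).trans ?_
      exact abs_norm_sub_norm_le _ _
    have : c / max c ‖u‖ - c / max c ‖v‖ =
        (c / max c ‖u‖) * ((max c ‖v‖ - max c ‖u‖) / max c ‖v‖) := by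
      field_simp
    rw [norm_smul, this, Real.norm_eq_abs, abs_mul, abs_div (_ - _), abs_of_pos hv,
      abs_of_nonneg (by positivity : 0 ≤ c / max c ‖u‖)]
    calc c / max c ‖u‖ * (|max c ‖v‖ - max c ‖u‖| / max c ‖v‖) * ‖v‖
        ≤ 1 * (|max c ‖v‖ - max c ‖u‖| / max c ‖v‖) * max c ‖v‖ := by
          gcongr
          · exact (div_le_one hu).2 (le_max_left _ _)
          · exact le_max_right _ _
      _ = |max c ‖v‖ - max c ‖u‖| := by field_simp
      _ ≤ ‖u - v‖ := hm
  rw [key]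
  refine (norm_add_le _ _).trans ?_
  push_cast
  linarith

theorem LipschitzOnWith.exists_bounded_extension [FiniteDimensional ℝ E] {α : Type*}
    [PseudoMetricSpace α] {s : Set α} {f : α → E} {K : NNReal} (hf : LipschitzOnWith K f s)
    {c : ℝ} (hc : 0 < c) (hb : ∀ x ∈ s, ‖f x‖ ≤ c) :
    ∃ (K' : NNReal) (g : α → E), LipschitzWith K' g ∧ (∀ x, ‖g x‖ ≤ c) ∧ EqOn g f s := by
  obtain ⟨g, hg, hgs⟩ := hf.extend_finite_dimension
  refine ⟨_, saturate c ∘ g, (lipschitzWith_saturate hc).comp hg,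
    fun x => norm_saturate_le hc _, fun x hx => ?_⟩
  rw [Function.comp_apply, ← hgs hx, saturate_of_norm_le hc (hgs hx ▸ hb x hx)]

end Saturation

/-! ### Global solutions, uniqueness and backward flow -/

section ODE

variable {E : Type*} [NormedAddCommGroup E] [NormedSpace ℝ E]

/-- Since the field is bounded by `c` everywhere, the Picard ball may have radius `c T`, and one
step covers the whole interval. -/
theorem exists_solution_of_lipschitz_of_bounded [CompleteSpace E] {v : ℝ → E → E} {K c : NNReal}
    (hv : ∀ t, LipschitzWith K (v t)) (hcont : ∀ x, Continuous fun t => v t x)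
    (hb : ∀ t x, ‖v t x‖ ≤ c) (x₀ : E) {T : ℝ} (hT : 0 ≤ T) :
    ∃ x : ℝ → E, x 0 = x₀ ∧
      ∀ t ∈ Icc 0 T, HasDerivWithinAt x (v t (x t)) (Icc 0 T) t := by
  have hP : IsPicardLindelof v (⟨0, left_mem_Icc.2 hT⟩ : Icc 0 T) x₀ (c * T.toNNReal) 0 c K :=
    { lipschitzOnWith := fun t _ => (hv t).lipschitzOnWith
      continuousOn := fun x _ => (hcont x).continuousOn
      norm_le := fun t _ x _ => hb t x
      mul_max_le := by simp [hT] }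
  exact hP.exists_eq_forall_mem_Icc_hasDerivWithinAt₀

theorem dist_le_of_solutions {v : ℝ → E → E} {K : NNReal} (hv : ∀ t, LipschitzWith K (v t))
    {x y : ℝ → E} {T : ℝ}
    (hx : ∀ t ∈ Icc 0 T, HasDerivWithinAt x (v t (x t)) (Icc 0 T) t)
    (hy : ∀ t ∈ Icc 0 T, HasDerivWithinAt y (v t (y t)) (Icc 0 T) t) {t : ℝ} (ht : t ∈ Icc 0 T) :
    dist (x t) (y t) ≤ dist (x 0) (y 0) * Real.exp (K * t) := by
  have := dist_le_of_trajectories_ODE hv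
    (fun t ht => (hx t ht).continuousWithinAt)
    (fun t ht => (hx t (Ico_subset_Icc_self ht)).mono_of_mem_nhdsWithin
      (Icc_mem_nhdsGE_of_mem ht))
    (fun t ht => (hy t ht).continuousWithinAt)
    (fun t ht => (hy t (Ico_subset_Icc_self ht)).mono_of_mem_nhdsWithin
      (Icc_mem_nhdsGE_of_mem ht)) le_rfl t ht
  simpa using this

theorem HasDerivWithinAt.time_reversal {x : ℝ → E} {w : ℝ → E} {T : ℝ}
    (hx : ∀ t ∈ Icc 0 T, HasDerivWithinAt x (w t) (Icc 0 T) t) :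
    ∀ t ∈ Icc 0 T, HasDerivWithinAt (fun s => x (T - s)) (-w (T - t)) (Icc 0 T) t := by
  intro t ht
  have hmem : ∀ s ∈ Icc 0 T, T - s ∈ Icc 0 T := fun s hs =>
    ⟨sub_nonneg.2 hs.2, sub_le_self _ hs.1⟩
  have h := (hx _ (hmem t ht)).scomp t (h := fun s => T - s) (h' := -1)
    ((hasDerivWithinAt_id t (Icc 0 T)).const_sub T) (fun s hs => hmem s hs)
  simpa [Function.comp_def] using h

/-- A globally Lipschitz and bounded field can be solved backward from a terminal condition; the
initial value depends in a Lipschitz way on it. -/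
theorem exists_solution_terminal [CompleteSpace E] {v : ℝ → E → E} {K c : NNReal}
    (hv : ∀ t, LipschitzWith K (v t)) (hcont : ∀ x, Continuous fun t => v t x)
    (hb : ∀ t x, ‖v t x‖ ≤ c) {T : ℝ} (hT : 0 ≤ T) {x : ℝ → E}
    (hx : ∀ t ∈ Icc 0 T, HasDerivWithinAt x (v t (x t)) (Icc 0 T) t) (y : E) :
    ∃ z : ℝ → E, z T = y ∧ (∀ t ∈ Icc 0 T, HasDerivWithinAt z (v t (z t)) (Icc 0 T) t) ∧
      dist (z 0) (x 0) ≤ dist y (x T) * Real.exp (K * T) := by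
  have hv' : ∀ t, LipschitzWith K (fun p => -v (T - t) p) := fun t => (hv (T - t)).neg
  obtain ⟨p, hp0, hp⟩ := exists_solution_of_lipschitz_of_bounded
    (v := fun t p => -v (T - t) p) (c := c) hv'
    (fun q => ((hcont q).comp (continuous_const.sub continuous_id)).neg)
    (fun t q => by simpa using hb _ _) y hT
  refine ⟨fun t => p (T - t), by simpa using hp0, fun t ht => ?_, ?_⟩
  · simpa using HasDerivWithinAt.time_reversal hp t ht
  · have := dist_le_of_solutions hv' hp (HasDerivWithinAt.time_reversal hx)
      (right_mem_Icc.2 hT)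
    simpa [hp0] using this

end ODE

/-! ### Two auxiliary facts on norms and balls -/

theorem sqrt_sum_sq_le {ι : Type*} (s : Finset ι) {E : Type*} [SeminormedAddCommGroup E]
    {v : s → E} {b : ℝ} (hb : 0 ≤ b) (hv : ∀ j, ‖v j‖ ≤ b) :
    √(∑ j, ‖v j‖ ^ 2) ≤ √(s.card : ℝ) * b := by
  rw [← Real.sqrt_sq hb, ← Real.sqrt_mul (Nat.cast_nonneg _)]
  refine Real.sqrt_le_sqrt ?_
  calc ∑ j, ‖v j‖ ^ 2 ≤ ∑ _j : s, b ^ 2 :=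
        Finset.sum_le_sum fun j _ => pow_le_pow_left₀ (norm_nonneg _) (hv j) 2
    _ = s.card * b ^ 2 := by simp

/-- The condition says that every point outside `D` has distance at least `ρ`. Intersected with a
closed ball of the state space, the set is compact. -/
theorem isClosed_setOf_ball_subset {E : Type*} [PseudoMetricSpace E] (D : Set E) (ρ : ℝ) :
    IsClosed {x | Metric.ball x ρ ⊆ D} := by
  have : {x | Metric.ball x ρ ⊆ D} = ⋂ z ∈ Dᶜ, {x | ρ ≤ dist z x} := by
    ext x
    simp only [mem_ofPred_eq, mem_iInter, mem_compl_iff, subset_def, Metric.mem_ball]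
    exact forall_congr' fun z => by rw [← not_lt, not_imp_not]
  rw [this]
  exact isClosed_biInter fun z _ => isClosed_le continuous_const (continuous_const.dist
    continuous_id)

/-! ### Extended dynamics and quantitative invariance -/

namespace MultiAgentSystem

variable {N n : ℕ} (sys : MultiAgentSystem N n)

theorem norm_f_sub_f_le {i : Fin N} {x x' : Space n} {y y' : sys.nbr i → Space n}
    (hx : x ∈ sys.D) (hx' : x' ∈ sys.D) (hy : ∀ j, y j ∈ sys.D) (hy' : ∀ j, y' j ∈ sys.D)
    {b : ℝ} (hb : 0 ≤ b) (hyb : ∀ j, ‖y j - y' j‖ ≤ b) :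
    ‖sys.f i x y - sys.f i x' y'‖ ≤
      sys.L₂ * ‖x - x'‖ + sys.L₁ * √((sys.nbr i).card : ℝ) * b := by
  calc ‖sys.f i x y - sys.f i x' y'‖
      ≤ ‖sys.f i x y - sys.f i x' y‖ + ‖sys.f i x' y - sys.f i x' y'‖ :=
        norm_sub_le_norm_sub_add_norm_sub _ _ _
    _ ≤ sys.L₂ * ‖x - x'‖ + sys.L₁ * (√((sys.nbr i).card : ℝ) * b) := by
        gcongr
        · exact sys.lipschitz_own i x hx x' hx' y hy
        · exact (sys.lipschitz_nbr i x' hx' y y' hy hy').trans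
            (mul_le_mul_of_nonneg_left (sqrt_sum_sq_le _ hb hyb) sys.L₁_pos.le)
    _ = _ := by ring

theorem lipschitzOnWith_f (i : Fin N) :
    LipschitzOnWith (sys.L₂ + sys.L₁ * √((sys.nbr i).card : ℝ)).toNNReal
      (fun p : Space n × (sys.nbr i → Space n) => sys.f i p.1 p.2)
      {p | p.1 ∈ sys.D ∧ ∀ j, p.2 j ∈ sys.D} := by
  refine LipschitzOnWith.of_dist_le_mul fun p hp q hq => ?_
  have h1 := sys.L₁_pos
  have h2 := sys.L₂_pos
  rw [dist_eq_norm, dist_eq_norm, Real.coe_toNNReal _ (by positivity)]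
  refine (sys.norm_f_sub_f_le hp.1 hq.1 hp.2 hq.2 (norm_nonneg (p - q)) fun j =>
    (norm_le_pi_norm (p - q).2 j).trans (norm_snd_le (p - q))).trans ?_
  rw [add_mul]
  gcongr
  exact norm_fst_le (p - q)

/-- A globally Lipschitz extension, bounded by `M`, of the feedback terms. -/
structure IsExtension (g : (m : Fin N) → Space n × (sys.nbr m → Space n) → Space n)
    (K : NNReal) : Prop where
  lipschitz : ∀ m, LipschitzWith K (g m)
  norm_le : ∀ m p, ‖g m p‖ ≤ sys.M
  eq_f : ∀ m x y, x ∈ sys.D → (∀ j, y j ∈ sys.D) → g m (x, y) = sys.f m x y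

theorem exists_isExtension : ∃ g K, sys.IsExtension g K := by
  choose K g hK hM hg using fun m => (sys.lipschitzOnWith_f m).exists_bounded_extension sys.M_pos
    (fun p hp => sys.norm_f_le m p.1 hp.1 p.2 hp.2)
  exact ⟨g, Finset.univ.sup K,
    fun m => (hK m).weaken (Finset.le_sup (f := K) (Finset.mem_univ m)), hM,
    fun m x y hx hy => hg m ⟨hx, hy⟩⟩

theorem lipschitzWith_pair (m : Fin N) :
    LipschitzWith 1 (fun x : Fin N → Space n => (x m, fun j : sys.nbr m => x j)) := by
  refine LipschitzWith.of_dist_le_mul fun x y => ?_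
  rw [NNReal.coe_one, one_mul, Prod.dist_eq]
  exact max_le (dist_le_pi_dist x y m)
    ((dist_pi_le_iff dist_nonneg).2 fun j => dist_le_pi_dist x y j)

variable {sys} {g : (m : Fin N) → Space n × (sys.nbr m → Space n) → Space n} {K : NNReal}

theorem _root_.Continuous.piecewiseContinuous {E : Type*} [TopologicalSpace E] {v : ℝ → E}
    (hv : Continuous v) : PiecewiseContinuous v := by
  refine ⟨fun T => ?_, fun t _ => ⟨v t, hv.continuousAt.mono_left nhdsWithin_le_nhds⟩,
    fun t _ => ⟨v t, hv.continuousAt.mono_left nhdsWithin_le_nhds⟩⟩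
  convert Set.finite_empty
  ext t
  simp [hv.continuousWithinAt]

/-- An open loop solution with continuous input is differentiable. -/
theorem IsOpenLoopSolution.hasDerivWithinAt (hg : sys.IsExtension g K)
    {v x : Fin N → ℝ → Space n} (hv : ∀ m, Continuous (v m)) (hx : sys.IsOpenLoopSolution v x)
    (T : ℝ) : ∀ t ∈ Icc 0 T, HasDerivWithinAt (fun t m => x m t)
      (fun m => g m (x m t, fun j => x j t) + v m t) (Icc 0 T) t := by
  intro t ht
  rw [hasDerivWithinAt_pi]
  intro m
  set F : ℝ → Space n := fun s => g m (x m s, fun j => x j s) + v m s with hF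
  have hFc : ContinuousOn F (Icc 0 T) := by
    refine ContinuousOn.add ((hg.lipschitz m).continuous.comp_continuousOn ?_)
      (hv m).continuousOn
    exact ((hx.1 m).prodMk (continuousOn_pi.2 fun j : sys.nbr m => hx.1 j)).mono Icc_subset_Ici_self
  have : Fact (t ∈ Icc 0 T) := ⟨ht⟩
  have hd : HasDerivWithinAt (fun u => ∫ s in (0 : ℝ)..u, F s) (F t) (Icc 0 T) t :=
    intervalIntegral.integral_hasDerivWithinAt_right
      ((hFc.mono (Icc_subset_Icc le_rfl ht.2)).intervalIntegrable_of_Icc ht.1)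
      (hFc.stronglyMeasurableAtFilter_nhdsWithin measurableSet_Icc t)
      (hFc.continuousWithinAt ht)
  have heq : ∀ u ∈ Icc 0 T, x m u = x m 0 + ∫ s in (0 : ℝ)..u, F s := by
    intro u hu
    rw [hx.2.2 m u hu.1]
    congr 1
    refine intervalIntegral.integral_congr fun s hs => ?_
    rw [uIcc_of_le hu.1] at hs
    simp only [hF]
    rw [hg.eq_f m _ _ (hx.2.1 m s hs.1) fun j => hx.2.1 j s hs.1]
  exact (hd.const_add (x m 0)).congr heq (heq t ht)

/-- Quantitative invariance: the distance to the complement of `D` decays at most exponentially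
along solutions of the extended system with admissible inputs. -/
theorem ball_subset_of_solution (hIA : sys.InvarianceAssumption) (hg : sys.IsExtension g K)
    {u : Fin N → ℝ → Space n} (hu : ∀ m, Continuous (u m)) (hub : ∀ m t, ‖u m t‖ ≤ sys.vmax)
    {T : ℝ} (hT : 0 ≤ T) {x : ℝ → Fin N → Space n}
    (hx : ∀ t ∈ Icc 0 T, HasDerivWithinAt x
      (fun m => g m (x t m, fun j => x t j) + u m t) (Icc 0 T) t)
    {ρ : ℝ} (hρ : ∀ m, Metric.ball (x 0 m) ρ ⊆ sys.D) (m : Fin N) :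
    Metric.ball (x T m) (ρ * Real.exp (-(K * T))) ⊆ sys.D := by
  intro z hz
  set v : ℝ → (Fin N → Space n) → Fin N → Space n :=
    fun t x m => g m (x m, fun j => x j) + u m t with hv
  -- The input does not depend on the state, so it does not enter the Lipschitz constant; hence the
  -- decay rate depends on `g` only.
  have hvlip : ∀ t, LipschitzWith K (v t) := fun t => by
    refine LipschitzWith.of_dist_le_mul fun p q => (dist_pi_le_iff (by positivity)).2 fun m => ?_
    rw [dist_add_right]
    simpa using ((hg.lipschitz m).comp (sys.lipschitzWith_pair m)).dist_le_mul p q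
  have hvc : ∀ p, Continuous fun t => v t p := fun p =>
    continuous_pi fun m => continuous_const.add (hu m)
  have hM := sys.M_pos
  have hvm := sys.vmax_pos
  have hvb : ∀ t p, ‖v t p‖ ≤ (sys.M + sys.vmax).toNNReal := fun t p => by
    rw [Real.coe_toNNReal _ (by positivity)]
    exact (pi_norm_le_iff_of_nonneg (by positivity)).2 fun m =>
      norm_add_le_of_le (hg.norm_le m _) (hub m t)
  -- Move only component `m` of the final state to `z` and flow back under the same input. The
  -- growth factor `exp (K T)` cancels the decay in the radius, so the initial state still lies in
  -- `D^N`.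
  obtain ⟨ζ, hζT, hζ, hζ0⟩ := exists_solution_terminal hvlip hvc hvb hT hx
    (Function.update (x T) m z)
  have hdist : dist (Function.update (x T) m z) (x T) = dist z (x T m) := by
    refine le_antisymm ((dist_pi_le_iff dist_nonneg).2 fun j => ?_) ?_
    · rcases eq_or_ne j m with rfl | h
      · simp
      · simp [h]
    · simpa using dist_le_pi_dist (Function.update (x T) m z) (x T) m
  have hlt : dist (ζ 0) (x 0) < ρ := by
    refine hζ0.trans_lt ?_
    rw [hdist]
    have := mul_lt_mul_of_pos_right (Metric.mem_ball.1 hz) (Real.exp_pos (K * T))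
    rwa [mul_assoc, ← Real.exp_add, neg_add_cancel, Real.exp_zero, mul_one] at this
  -- The invariant solution from `ζ 0` coincides with `ζ` by uniqueness, which puts `z` in `D`.
  obtain ⟨ξ, hξ0, hξ⟩ := hIA (ζ 0)
    (fun j => hρ j (Metric.mem_ball.2 ((dist_le_pi_dist _ _ j).trans_lt hlt))) u
    (fun j => (hu j).piecewiseContinuous) (fun j t _ => hub j t)
  have hd := dist_le_of_solutions hvlip (hξ.hasDerivWithinAt hg hu T) hζ (right_mem_Icc.2 hT)
  have h0 : (fun j => ξ j 0) = ζ 0 := funext hξ0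
  rw [h0, dist_self, zero_mul] at hd
  have hT' := congrFun (dist_le_zero.1 hd) m
  rw [hζT, Function.update_self] at hT'
  rw [← hT']
  exact hξ.2.1 m T hT

end MultiAgentSystem

/-! ### Existence and a priori bounds for closed-loop solutions -/

namespace MultiAgentSystem

variable {N n : ℕ} {sys : MultiAgentSystem N n} {I : Type*}

theorem PropertyP.norm_le {S : I → Set (Space n)} {δt : ℝ} {W : Set (Space n)} {m : Fin N}
    {l : Fin N → I} {K : sys.FeedbackLaw m} (hP : sys.PropertyP S δt W m (sys.pr m l) K)
    {w : Space n} (hw : w ∈ W) {x₀ x : Fin N → Space n} (hx₀ : ∀ j, x₀ j ∈ S (l j))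
    (hxD : ∀ j, x j ∈ sys.D) (hx : ∀ j, ‖x j - x₀ j‖ ≤ sys.Rmax δt) {t : ℝ}
    (ht : t ∈ Icc 0 δt) : ‖K.k (x₀ m) w t (x m) (fun j => x j)‖ ≤ sys.vmax := by
  have hmem : ∀ j, x j ∈ (S (l j) + Metric.closedBall 0 (sys.Rmax δt)) ∩ sys.D := fun j =>
    ⟨⟨x₀ j, hx₀ j, x j - x₀ j, by simpa using hx j, by simp⟩, hxD j⟩
  exact hP.P2 (x₀ m) (hx₀ m) w hw t ht
    ((EReal.coe_le_coe_iff.2 ht.2).trans_lt (hP.P3 (x₀ m) (hx₀ m) w hw)) _ (hmem m) _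
    fun j => hmem j

theorem exists_pos_ball_subset {x₀ : Fin N → Space n} (hx₀ : ∀ m, x₀ m ∈ sys.D) :
    ∃ ρ > 0, ∀ m, Metric.ball (x₀ m) ρ ⊆ sys.D := by
  have hopen : IsOpen (Set.pi univ fun _ : Fin N => sys.D) :=
    isOpen_set_pi finite_univ fun _ _ => sys.isOpen_D
  obtain ⟨ρ, hρ, h⟩ := Metric.isOpen_iff.1 hopen x₀ fun m _ => hx₀ m
  refine ⟨ρ, hρ, fun m z hz => ?_⟩
  have : Function.update x₀ m z ∈ Metric.ball x₀ ρ := by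
    refine (dist_pi_lt_iff hρ).2 fun j => ?_
    rcases eq_or_ne j m with rfl | hj
    · simpa using hz
    · simpa [hj] using hρ
  simpa using h this m (mem_univ m)

/-- Feedback laws with property (P) admit closed loop solutions on `[0, δt]`. -/
theorem exists_closedLoopSolution (hIA : sys.InvarianceAssumption) {S : I → Set (Space n)}
    (hSD : ∀ l, S l ⊆ sys.D) {δt : ℝ} (hδt : 0 < δt) {W : Set (Space n)} {l : Fin N → I}
    {K : (m : Fin N) → sys.FeedbackLaw m}
    (hP : ∀ m, sys.PropertyP S δt W m (sys.pr m l) (K m)) {w : Fin N → Space n}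
    (hw : ∀ m, w m ∈ W) {x₀ : Fin N → Space n} (hx₀ : ∀ m, x₀ m ∈ S (l m)) :
    ∃ x, sys.IsClosedLoopSolution δt K w x₀ x ∧
      ∀ m, ∀ t ∈ Icc 0 δt, ‖x m t - x₀ m‖ ≤ sys.Rmax δt := by
  obtain ⟨g, C, hg⟩ := sys.exists_isExtension
  obtain ⟨ρ, hρ, hball⟩ := exists_pos_ball_subset (sys := sys) fun m => hSD _ (hx₀ m)
  have hM := sys.M_pos
  have hvm := sys.vmax_pos
  -- The margin depends on the feedback terms only and is fixed before the laws are extended, so the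
  -- compact sets `Q m` can be chosen first without circularity.
  set ρ' := ρ * Real.exp (-(C * δt)) with hρ'
  have hρ'0 : 0 < ρ' := by positivity
  set Q : Fin N → Set (Space n) := fun m =>
    Metric.closedBall (x₀ m) (sys.Rmax δt) ∩ {x | Metric.ball x ρ' ⊆ sys.D} with hQ
  have hQc : ∀ m, IsCompact (Q m) := fun m =>
    (isCompact_closedBall _ _).inter_right (isClosed_setOf_ball_subset _ _)
  have hQD : ∀ m, Q m ⊆ sys.D := fun m x hx => hx.2 (Metric.mem_ball_self hρ'0)
  set P : (m : Fin N) → Set (ℝ × Space n × (sys.nbr m → Space n)) := fun m =>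
    Icc 0 δt ×ˢ (Q m ×ˢ Set.pi univ fun j : sys.nbr m => Q j) with hPdef
  have hPc : ∀ m, IsCompact (P m) := fun m =>
    isCompact_Icc.prod ((hQc m).prod (isCompact_univ_pi fun j : sys.nbr m => hQc j))
  have hT : ∀ m, ∀ t ∈ Icc 0 δt, (t : EReal) < (K m).T (x₀ m) (w m) := fun m t ht =>
    (EReal.coe_le_coe_iff.2 ht.2).trans_lt ((hP m).P3 (x₀ m) (hx₀ m) (w m) (hw m))
  have hext : ∀ m, ∃ (C' : NNReal) (k : ℝ × Space n × (sys.nbr m → Space n) → Space n),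
      LipschitzWith C' k ∧ (∀ p, ‖k p‖ ≤ sys.vmax) ∧
      EqOn k (fun p => (K m).k (x₀ m) (w m) p.1 p.2.1 p.2.2) (P m) := fun m => by
    have hloc := ((hP m).P1 (x₀ m) (hx₀ m) (w m) (hw m)).mono (s := P m)
      fun p hp => ⟨hp.1.1, hT m _ hp.1, hQD m hp.2.1, fun j => hQD j (hp.2.2 j (mem_univ j))⟩
    obtain ⟨C', hC'⟩ := hloc.exists_lipschitzOnWith_of_compact (hPc m)
    refine hC'.exists_bounded_extension hvm fun p hp => ?_
    have hmem : ∀ j : Fin N, ∀ x ∈ Q j,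
        x ∈ (S (l j) + Metric.closedBall 0 (sys.Rmax δt)) ∩ sys.D := fun j x hx =>
      ⟨⟨x₀ j, hx₀ j, x - x₀ j, by simpa [dist_eq_norm] using hx.1, by simp⟩, hQD j hx⟩
    exact (hP m).P2 (x₀ m) (hx₀ m) (w m) (hw m) p.1 hp.1 (hT m _ hp.1) _ (hmem m _ hp.2.1) _
      fun j => hmem j _ (hp.2.2 j (mem_univ j))
  choose C' k hkL hkb hk using hext
  set v : ℝ → (Fin N → Space n) → Fin N → Space n :=
    fun t x m => g m (x m, fun j => x j) + k m (t, x m, fun j => x j) with hv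
  have hvlip : ∀ t, LipschitzWith (C + Finset.univ.sup C') (v t) := fun t => by
    refine LipschitzWith.of_dist_le_mul fun p q => (dist_pi_le_iff (by positivity)).2 fun m => ?_
    refine (dist_add_add_le _ _ _ _).trans ?_
    rw [NNReal.coe_add, add_mul]
    gcongr
    · simpa using ((hg.lipschitz m).comp (sys.lipschitzWith_pair m)).dist_le_mul p q
    · have h1 := (((hkL m).weaken (Finset.le_sup (f := C') (Finset.mem_univ m))).comp
        ((LipschitzWith.prodMk_left t).comp (sys.lipschitzWith_pair m))).dist_le_mul p q
      simpa using h1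
  have hvc : ∀ p, Continuous fun t => v t p := fun p => continuous_pi fun m =>
    continuous_const.add ((hkL m).continuous.comp (continuous_id.prodMk continuous_const))
  have hvb' : ∀ t p m, ‖v t p m‖ ≤ sys.M + sys.vmax := fun t p m =>
    norm_add_le_of_le (hg.norm_le m _) (hkb m _)
  have hvb : ∀ t p, ‖v t p‖ ≤ (sys.M + sys.vmax).toNNReal := fun t p => by
    rw [Real.coe_toNNReal _ (by positivity)]
    exact (pi_norm_le_iff_of_nonneg (by positivity)).2 fun m => hvb' t p m
  obtain ⟨x, hx0, hx⟩ := exists_solution_of_lipschitz_of_bounded hvlip hvc hvb x₀ hδt.le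
  have hxc : ContinuousOn x (Icc 0 δt) := fun t ht => (hx t ht).continuousWithinAt
  have hbound : ∀ m, ∀ t ∈ Icc 0 δt, ‖x t m - x₀ m‖ ≤ sys.Rmax δt := fun m t ht => by
    have h := norm_image_sub_le_of_norm_deriv_le_segment' (f := fun t => x t m)
      (fun s hs => hasDerivWithinAt_pi.1 (hx s hs) m) (fun s _ => hvb' s (x s) m) t ht
    rw [hx0] at h
    refine h.trans ?_
    rw [Rmax, mul_comm]
    gcongr
    linarith [ht.2]
  -- Along the solution the extended feedback is a function of time alone, hence an admissible
  -- open-loop input. Freezing the solution outside `[0, δt]` makes this input continuous on the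
  -- whole line.
  have hinv : ∀ m, ∀ t ∈ Icc 0 δt, Metric.ball (x t m) ρ' ⊆ sys.D := fun m t ht => by
    set e : ℝ → Fin N → Space n := fun s => IccExtend hδt.le (fun r : Icc 0 δt => x r) s with he
    have hec : Continuous e := (continuousOn_iff_continuous_domRestrict.1 hxc).Icc_extend'
    have hee : ∀ s ∈ Icc 0 t, e s = x s := fun s hs =>
      IccExtend_of_mem hδt.le (fun r : Icc 0 δt => x r) ⟨hs.1, hs.2.trans ht.2⟩
    have hsol := ball_subset_of_solution hIA hg (x := x) (T := t) (ρ := ρ)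
      (u := fun m s => k m (s, e s m, fun j => e s j))
      (fun m => (hkL m).continuous.comp (continuous_id.prodMk
        ((sys.lipschitzWith_pair m).continuous.comp hec)))
      (fun m s => hkb m _) ht.1 (fun s hs => by
        have := (hx s ⟨hs.1, hs.2.trans ht.2⟩).mono (Icc_subset_Icc le_rfl ht.2)
        simp only [hee s hs]
        exact this) (by rwa [hx0]) m
    refine (Metric.ball_subset_ball ?_).trans hsol
    rw [hρ']
    gcongr
    exact ht.2
  have hxQ : ∀ m, ∀ t ∈ Icc 0 δt, x t m ∈ Q m := fun m t ht =>
    ⟨by simpa [dist_eq_norm] using hbound m t ht, hinv m t ht⟩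
  refine ⟨fun m t => x t m, fun m => ⟨congrFun hx0 m, fun t ht =>
    ⟨hQD m (hxQ m t ht), hT m t ht, ?_⟩⟩, hbound⟩
  have h := hasDerivWithinAt_pi.1 (hx t ht) m
  have hkm := hk m (x := (t, x t m, fun j => x t j))
    ⟨ht, hxQ m t ht, fun j _ => hxQ j t ht⟩
  simp only [hv] at h
  rw [hkm, hg.eq_f m _ _ (hQD m (hxQ m t ht)) fun j => hQD j (hxQ j t ht)] at h
  exact h

/-- Closed loop solutions under laws with property (P) move by at most `R_max` before `δt`. -/
theorem IsClosedLoopSolution.norm_sub_le {S : I → Set (Space n)} {δt : ℝ} {W : Set (Space n)}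
    {l : Fin N → I} {K : (m : Fin N) → sys.FeedbackLaw m}
    (hP : ∀ m, sys.PropertyP S δt W m (sys.pr m l) (K m)) {w : Fin N → Space n}
    (hw : ∀ m, w m ∈ W) {x₀ : Fin N → Space n} (hx₀ : ∀ m, x₀ m ∈ S (l m))
    {x : Fin N → ℝ → Space n} (hx : sys.IsClosedLoopSolution δt K w x₀ x) {t : ℝ}
    (ht : t ∈ Ico 0 δt) (m : Fin N) : ‖x m t - x₀ m‖ ≤ sys.Rmax δt := by
  have hM := sys.M_pos
  have hvm := sys.vmax_pos
  have hδt : 0 < δt := ht.1.trans_lt ht.2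
  rcases ht.1.eq_or_lt with rfl | ht0
  · rw [(hx m).1, sub_self, norm_zero, Rmax]
    positivity
  -- Because `t < δt`, the slope `c` strictly exceeds the maximal speed `M + vmax`. When the
  -- displacement equals `c s`, it is still at most `R_max`, so (P2) applies and the barrier cannot
  -- be crossed. The sup norm over all agents is needed since (P2) involves the neighbors.
  set c := sys.Rmax δt / t with hc
  have hct : c * t = sys.Rmax δt := by rw [hc]; field_simp
  have hR : 0 < sys.Rmax δt := by rw [Rmax]; positivity
  have hc' : sys.M + sys.vmax < c := by
    rw [hc, lt_div_iff₀ ht0, Rmax, mul_comm]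
    exact mul_lt_mul_of_pos_right ht.2 (by positivity)
  have hIcc : Icc 0 t ⊆ Icc 0 δt := Icc_subset_Icc le_rfl ht.2.le
  have hd : ∀ s ∈ Icc 0 δt, HasDerivWithinAt (fun s j => x j s - x₀ j)
      (fun j => sys.f j (x j s) (fun j' => x j' s) +
        (K j).k (x₀ j) (w j) s (x j s) (fun j' => x j' s)) (Icc 0 δt) s := fun s hs =>
    hasDerivWithinAt_pi.2 fun j => ((hx j).2 s hs).2.2.sub_const _
  have key := image_norm_le_of_norm_deriv_right_lt_deriv_boundary
    (f := fun s j => x j s - x₀ j) (B := fun s => c * s) (B' := fun _ => c) (a := 0) (b := t)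
    (fun s hs => (hd s (hIcc hs)).continuousWithinAt.mono hIcc)
    (fun s hs => (hd s (hIcc (Ico_subset_Icc_self hs))).mono_of_mem_nhdsWithin
      (Icc_mem_nhdsGE_of_mem ⟨hs.1, hs.2.trans ht.2⟩))
    (by
      have : (fun j => x j 0 - x₀ j) = 0 := funext fun j => by simp [(hx j).1]
      simp only [this]
      simp)
    (fun s => by simpa using (hasDerivAt_id s).const_mul c)
    (fun s hs hs' => by
      have hsI : s ∈ Icc 0 δt := hIcc (Ico_subset_Icc_self hs)
      refine lt_of_le_of_lt ((pi_norm_le_iff_of_nonneg (by positivity)).2 fun j => ?_) hc'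
      have hle : ∀ j, ‖x j s - x₀ j‖ ≤ sys.Rmax δt := fun j => by
        refine (norm_le_pi_norm (fun j => x j s - x₀ j) j).trans ?_
        rw [hs', ← hct]
        have : 0 ≤ c := by positivity
        gcongr
        exact hs.2.le
      have hD : ∀ j, x j s ∈ sys.D := fun j => ((hx j).2 s hsI).1
      exact norm_add_le_of_le (sys.norm_f_le j _ (hD j) _ fun j' => hD j')
        ((hP j).norm_le (hw j) (x := fun j => x j s) hx₀ hD hle hsI))
    (right_mem_Icc.2 ht0.le)
  have h := (norm_le_pi_norm (fun j => x j t - x₀ j) m).trans key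
  rwa [hct] at h

end MultiAgentSystem

/-! ### Reduction of the restrictions to a quadratic inequality -/

/-- Completing the square: `4a(at² - bt + d) = (2at - b)² - (b² - 4ad)`. -/
theorem quadratic_nonpos_of_abs_le_sqrt {a b d t : ℝ} (ha : 0 < a) (hdisc : 0 ≤ b ^ 2 - 4 * a * d)
    (h : |2 * a * t - b| ≤ √(b ^ 2 - 4 * a * d)) : a * t ^ 2 - b * t + d ≤ 0 := by
  have h2 := (sq_le_sq₀ (abs_nonneg _) (Real.sqrt_nonneg _)).2 h
  rw [sq_abs, Real.sq_sqrt hdisc] at h2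
  have h3 : 4 * a * (a * t ^ 2 - b * t + d) ≤ 0 := by linarith
  exact nonpos_of_mul_nonpos_right h3 (by positivity)

theorem le_upperTime_iff {M vmax L lam d t : ℝ} (hM : 0 < M) (hL : 0 < L) :
    t ≤ upperTime M vmax L lam d ↔ 2 * (M * L) * t - (1 - lam) * vmax ≤
      √(((1 - lam) * vmax) ^ 2 - 4 * (M * L) * d) := by
  rw [upperTime, le_div_iff₀ (by positivity), mul_pow, ← mul_assoc 4,
    sub_le_iff_le_add', show 2 * (M * L) * t = t * (2 * M * L) by ring]

theorem lowerTime_le_iff {M vmax L lam d t : ℝ} (hM : 0 < M) (hL : 0 < L) :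
    lowerTime M vmax L lam d ≤ t ↔ -√(((1 - lam) * vmax) ^ 2 - 4 * (M * L) * d) ≤
      2 * (M * L) * t - (1 - lam) * vmax := by
  rw [lowerTime, div_le_iff₀ (by positivity), mul_pow, ← mul_assoc 4,
    le_sub_iff_add_le, neg_add_eq_sub, show 2 * (M * L) * t = t * (2 * M * L) by ring]

/-- All cases of the restrictions amount to one quadratic inequality. -/
theorem AdmissibleParameters.quadratic_nonpos {M vmax L lam mu d δt : ℝ} (hM : 0 < M)
    (hv : 0 < vmax) (hL : 0 < L) (hlam : 0 < lam) (hmu : 0 < mu)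
    (h : AdmissibleParameters M vmax L lam mu d δt) :
    M * L * δt ^ 2 - (1 - lam) * vmax * δt + d ≤ 0 := by
  have hML : 0 < M * L := by positivity
  have caseI : d ≤ dBound M vmax L lam →
      δt ∈ Icc (lowerTime M vmax L lam d) (upperTime M vmax L lam d) →
      M * L * δt ^ 2 - (1 - lam) * vmax * δt + d ≤ 0 := fun hd ht => by
    rw [dBound, le_div_iff₀ (by positivity)] at hd
    exact quadratic_nonpos_of_abs_le_sqrt hML (by linarith [mul_pow (1 - lam) vmax 2])
      (abs_le.2 ⟨(lowerTime_le_iff hM hL).1 ht.1, (le_upperTime_iff hM hL).1 ht.2⟩)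
  have caseIII : d ∈ Ioc 0 (dBoundMu M vmax L lam mu) →
      δt ∈ Icc (mu / (2 * lam * vmax) * d) (upperTime M vmax L lam d) →
      M * L * δt ^ 2 - (1 - lam) * vmax * δt + d ≤ 0 := fun hd ht => by
    have hd2 := hd.2
    rw [dBoundMu, le_div_iff₀ (by positivity)] at hd2
    set t₀ := mu / (2 * lam * vmax) * d with ht₀
    -- The bound `dBoundMu` is exactly the condition that the quadratic be nonpositive at `t₀`. So
    -- `t₀` is at least the smaller root, and so is any `δt ≥ t₀`.
    have hq : M * L * t₀ ^ 2 - (1 - lam) * vmax * t₀ + d ≤ 0 := by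
      have : M * L * t₀ ^ 2 - (1 - lam) * vmax * t₀ + d =
          d / (4 * lam ^ 2 * vmax ^ 2) * (d * (mu ^ 2 * M * L) -
            2 * (lam * (1 - lam) * mu - 2 * lam ^ 2) * vmax ^ 2) := by
        rw [ht₀]; field_simp; ring
      rw [this]
      have := hd.1
      exact mul_nonpos_of_nonneg_of_nonpos (by positivity) (by linarith)
    have hsq : (2 * (M * L) * t₀ - (1 - lam) * vmax) ^ 2 ≤
        ((1 - lam) * vmax) ^ 2 - 4 * (M * L) * d := by
      have := mul_nonpos_of_nonneg_of_nonpos (by positivity : 0 ≤ 4 * (M * L)) hq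
      linarith
    refine quadratic_nonpos_of_abs_le_sqrt hML ((sq_nonneg _).trans hsq)
      (abs_le.2 ⟨?_, (le_upperTime_iff hM hL).1 ht.2⟩)
    have h1 := (abs_le.1 (Real.abs_le_sqrt hsq)).1
    have h2 := mul_le_mul_of_nonneg_left ht.1 (by positivity : 0 ≤ 2 * (M * L))
    linarith
  rcases h with ⟨-, hd, ht⟩ | ⟨-, ⟨hd, ht⟩ | ⟨hd, ht⟩⟩ | ⟨-, hd, ht⟩
  · exact caseI hd.2 ht
  · exact caseIII hd ht
  · exact caseI hd.2 ht
  · exact caseIII hd ht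

theorem norm_sub_le_cellDiameter {n : ℕ} {I : Type*} {D : Set (Space n)} {S : I → Set (Space n)}
    (hS : IsCellDecomposition D S) {l : I} {x y : Space n} (hx : x ∈ S l) (hy : y ∈ S l) :
    ‖x - y‖ ≤ cellDiameter S := by
  obtain ⟨C, hC⟩ := hS.diam_bounded
  have hb : BddAbove (range fun l => Metric.diam (S l)) := by
    refine ⟨max C 0, ?_⟩
    rintro _ ⟨l, rfl⟩
    exact Metric.diam_le_of_forall_dist_le (le_max_right _ _) fun x hx y hy =>
      (hC l x hx y hy).trans (le_max_left _ _)
  rw [← dist_eq_norm]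
  exact (Metric.dist_le_diam_of_mem (Metric.isBounded_iff.2 ⟨C, fun x hx y hy => hC l x hx y hy⟩)
    hx hy).trans (le_ciSup hb l)

/-! ### Cell configurations and saturated laws -/

namespace MultiAgentSystem

variable {N n : ℕ} {sys : MultiAgentSystem N n} {I : Type*}

theorem le_L (i : Fin N) :
    3 * sys.L₂ + 4 * sys.L₁ * √((sys.nbr i).card : ℝ) ≤ sys.L :=
  le_ciSup (f := fun i : Fin N => 3 * sys.L₂ + 4 * sys.L₁ * √((sys.nbr i).card : ℝ))
    (finite_range _).bddAbove i

theorem L_pos (i : Fin N) : 0 < sys.L := by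
  have h1 := sys.L₁_pos
  have h2 := sys.L₂_pos
  exact lt_of_lt_of_le (by positivity) (le_L i)

/-- A family over all agents with prescribed values at `i` and at its neighbors. -/
def extendConfig {α : Type*} (i : Fin N) (a : α) (b : sys.nbr i → α) (m : Fin N) : α :=
  if h : m ∈ sys.nbr i then b ⟨m, h⟩ else a

@[simp] theorem extendConfig_self {α : Type*} (i : Fin N) (a : α) (b : sys.nbr i → α) :
    extendConfig i a b i = a := dif_neg (sys.not_mem_nbr i)

@[simp] theorem extendConfig_nbr {α : Type*} (i : Fin N) (a : α) (b : sys.nbr i → α)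
    (j : sys.nbr i) : extendConfig i a b j = b j := dif_pos j.2

@[simp] theorem pr_extendConfig (i : Fin N) (li : sys.CellConfig I i) :
    sys.pr i (extendConfig i li.1 li.2) = li := by
  simp [pr]

theorem extendConfig_mem {S : I → Set (Space n)} {i : Fin N} {li : sys.CellConfig I i}
    {x : Space n} {y : sys.nbr i → Space n} (hx : x ∈ S li.1) (hy : ∀ j, y j ∈ S (li.2 j))
    (m : Fin N) : extendConfig i x y m ∈ S (extendConfig i li.1 li.2 m) := by
  unfold extendConfig
  split_ifs with h
  · exact hy ⟨m, h⟩
  · exact hx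

/-- The law that saturates `φ` at `vmax`, defined for all times. -/
noncomputable def saturatedLaw (i : Fin N)
    (φ : Space n → Space n → ℝ → Space n → (sys.nbr i → Space n) → Space n) :
    sys.FeedbackLaw i where
  T _ _ := ⊤
  k x₀ w t x y := saturate sys.vmax (φ x₀ w t x y)

theorem saturatedLaw_propertyP (S : I → Set (Space n)) (δt : ℝ) (W : Set (Space n)) (i : Fin N)
    (l : sys.CellConfig I i)
    {φ : Space n → Space n → ℝ → Space n → (sys.nbr i → Space n) → Space n}
    (hφ : ∀ x₀ w, ∃ C, LipschitzOnWith C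
      (fun p : ℝ × Space n × (sys.nbr i → Space n) => φ x₀ w p.1 p.2.1 p.2.2)
      {p | p.2.1 ∈ sys.D ∧ ∀ j, p.2.2 j ∈ sys.D}) :
    sys.PropertyP S δt W i l (saturatedLaw i φ) where
  P1 x₀ _ w _ := fun p _ => by
    obtain ⟨C, hC⟩ := hφ x₀ w
    exact ⟨_, _, self_mem_nhdsWithin, ((lipschitzWith_saturate sys.vmax_pos).comp_lipschitzOnWith
      (hC.mono fun q hq => hq.2.2))⟩
  P2 _ _ _ _ _ _ _ _ _ _ _ := norm_saturate_le sys.vmax_pos _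
  P3 _ _ _ _ := EReal.coe_lt_top _

theorem lipschitzOnWith_f_time (i : Fin N) : ∃ C, LipschitzOnWith C
    (fun p : ℝ × Space n × (sys.nbr i → Space n) => sys.f i p.2.1 p.2.2)
    {p | p.2.1 ∈ sys.D ∧ ∀ j, p.2.2 j ∈ sys.D} :=
  ⟨_, (sys.lipschitzOnWith_f i).comp LipschitzWith.prod_snd.lipschitzOnWith fun _ hp => hp⟩

/-- The family of laws that vanish except for the one of agent `i`. -/
noncomputable def soloLaw (i : Fin N) (Ki : sys.FeedbackLaw i) (m : Fin N) : sys.FeedbackLaw m :=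
  Function.update (β := sys.FeedbackLaw) (fun m => saturatedLaw m fun _ _ _ _ _ => 0) i Ki m

theorem soloLaw_propertyP {S : I → Set (Space n)} {δt : ℝ} {W : Set (Space n)} {i : Fin N}
    {l : Fin N → I} {Ki : sys.FeedbackLaw i} (hKi : sys.PropertyP S δt W i (sys.pr i l) Ki)
    (m : Fin N) : sys.PropertyP S δt W m (sys.pr m l) (soloLaw i Ki m) := by
  rcases eq_or_ne m i with rfl | h
  · simpa [soloLaw] using hKi
  · simp only [soloLaw, Function.update_of_ne h]
    exact saturatedLaw_propertyP _ _ _ _ _ fun _ _ =>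
      ⟨0, (LipschitzWith.const (0 : Space n)).lipschitzOnWith⟩

/-! ### Reference trajectories and the tracking law -/

section Parameters

variable {δt lam d : ℝ}

/-- Drop the square for the first bound; divide by `δt` and insert the definition of `L` for the
second. -/
theorem bounds_of_quadratic_nonpos (hδt : 0 < δt) (i : Fin N)
    (hq : sys.M * sys.L * δt ^ 2 - (1 - lam) * sys.vmax * δt + d ≤ 0) :
    d ≤ (1 - lam) * sys.vmax * δt ∧
    (3 * sys.L₂ + 4 * sys.L₁ * √((sys.nbr i).card : ℝ)) * (sys.M * δt) + δt⁻¹ * d ≤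
      (1 - lam) * sys.vmax := by
  have hM := sys.M_pos
  have hL := sys.L_pos i
  refine ⟨?_, ?_⟩
  · have : 0 ≤ sys.M * sys.L * δt ^ 2 := by positivity
    linarith
  · have h1 := mul_le_mul_of_nonneg_right (sys.le_L i) (by positivity : 0 ≤ sys.M * δt)
    have h2 : δt⁻¹ * (sys.M * sys.L * δt ^ 2 - (1 - lam) * sys.vmax * δt + d) ≤ 0 :=
      mul_nonpos_of_nonneg_of_nonpos (by positivity) hq
    have h3 : δt⁻¹ * (sys.M * sys.L * δt ^ 2 - (1 - lam) * sys.vmax * δt + d) =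
        sys.L * (sys.M * δt) - (1 - lam) * sys.vmax + δt⁻¹ * d := by
      field_simp
    linarith

variable {S : I → Set (Space n)} {i : Fin N} {li : sys.CellConfig I i} {xG : Space n}
  {yG : sys.nbr i → Space n}

/-- A saturated feedback replaces the true neighbors by their reference points. Started at those
points, the neighbors move by at most `R_max`, so the required input is at most `L₁ √N_i R_max ≤
vmax`, saturation is inactive, and component `i` of the closed-loop solution is `χ`. -/
theorem exists_referenceTrajectory (hIA : sys.InvarianceAssumption) (hSD : ∀ l, S l ⊆ sys.D)
    (hδt : 0 < δt) (hlam : 0 ≤ lam) (hd : 0 ≤ d)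
    (hq : sys.M * sys.L * δt ^ 2 - (1 - lam) * sys.vmax * δt + d ≤ 0) (hxG : xG ∈ S li.1)
    (hyG : ∀ j, yG j ∈ S (li.2 j)) : ∃ χ, sys.IsReferenceTrajectory δt i xG yG χ := by
  have hyD : ∀ j, yG j ∈ sys.D := fun j => hSD _ (hyG j)
  have hM := sys.M_pos
  have hv := sys.vmax_pos
  have hL₁ := sys.L₁_pos
  have hL₂ := sys.L₂_pos
  set Ki : sys.FeedbackLaw i := saturatedLaw i fun _ _ _ x y => sys.f i x yG - sys.f i x y
    with hKi
  have hPi : sys.PropertyP S δt univ i (sys.pr i (extendConfig i li.1 li.2)) Ki := by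
    refine saturatedLaw_propertyP _ _ _ _ _ fun _ _ => ?_
    obtain ⟨C, hC⟩ := sys.lipschitzOnWith_f_time i
    have h1 : LipschitzOnWith C
        (fun p : ℝ × Space n × (sys.nbr i → Space n) => sys.f i p.2.1 yG)
        {p | p.2.1 ∈ sys.D ∧ ∀ j, p.2.2 j ∈ sys.D} :=
      LipschitzOnWith.of_dist_le_mul fun p hp q hq => by
        refine (hC.dist_le_mul (p.1, p.2.1, yG) ⟨hp.1, hyD⟩ (q.1, q.2.1, yG) ⟨hq.1, hyD⟩).trans ?_
        gcongr
        simp only [Prod.dist_eq, dist_self]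
        exact max_le_max le_rfl (max_le_max le_rfl dist_nonneg)
    exact ⟨_, h1.sub hC⟩
  obtain ⟨x, hx, hxb⟩ := exists_closedLoopSolution hIA hSD hδt (soloLaw_propertyP hPi)
    (w := 0) (fun _ => mem_univ _) (extendConfig_mem hxG hyG)
  refine ⟨x i, by simpa using (hx i).1, fun t ht => ⟨((hx i).2 t ht).1, ?_⟩⟩
  have hder := ((hx i).2 t ht).2.2
  have hD : ∀ m, x m t ∈ sys.D := fun m => ((hx m).2 t ht).1
  have hR : 0 ≤ sys.Rmax δt := by rw [Rmax]; positivity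
  have hsat : ‖sys.f i (x i t) yG - sys.f i (x i t) (fun j => x j t)‖ ≤ sys.vmax := by
    refine (sys.norm_f_sub_f_le (hD i) (hD i) hyD (fun j => hD j) hR fun j => ?_).trans ?_
    · have := hxb j t ht
      rwa [extendConfig_nbr, norm_sub_rev] at this
    · rw [sub_self, norm_zero, mul_zero, zero_add]
      have hb := (bounds_of_quadratic_nonpos hδt i hq).2
      have h1 : sys.Rmax δt ≤ 4 * (sys.M * δt) := by
        have := mul_le_mul_of_nonneg_left sys.vmax_lt_M.le hδt.le
        have : 0 ≤ sys.M * δt := by positivity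
        rw [Rmax]; linarith
      have h2 := mul_le_mul_of_nonneg_left h1
        (by positivity : 0 ≤ sys.L₁ * √((sys.nbr i).card : ℝ))
      have h3 : 0 ≤ 3 * sys.L₂ * (sys.M * δt) := by positivity
      have h4 : 0 ≤ δt⁻¹ * d := by positivity
      have h5 : 0 ≤ lam * sys.vmax := by positivity
      linarith
  simp only [soloLaw, Function.update_self, hKi, saturatedLaw,
    saturate_of_norm_le sys.vmax_pos hsat, add_sub_cancel] at hder
  exact hder

/-- Allows extending this function of time to the whole line, as (P1) requires for a law defined for
all times. -/
theorem IsReferenceTrajectory.lipschitzOnWith {χ : ℝ → Space n}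
    (hχ : sys.IsReferenceTrajectory δt i xG yG χ) (hyD : ∀ j, yG j ∈ sys.D) :
    LipschitzOnWith (sys.L₂.toNNReal * sys.M.toNNReal) (fun t => sys.f i (χ t) yG)
      (Icc 0 δt) := by
  have h1 : LipschitzOnWith sys.M.toNNReal χ (Icc 0 δt) :=
    (convex_Icc 0 δt).lipschitzOnWith_of_nnnorm_hasDerivWithin_le
      (fun t ht => (hχ.2 t ht).2) fun t ht => by
        rw [← NNReal.coe_le_coe, coe_nnnorm, Real.coe_toNNReal _ sys.M_pos.le]
        exact sys.norm_f_le i _ (hχ.2 t ht).1 _ hyD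
  have h2 : LipschitzOnWith sys.L₂.toNNReal (fun x => sys.f i x yG) sys.D :=
    LipschitzOnWith.of_dist_le_mul fun x hx y hy => by
      rw [dist_eq_norm, dist_eq_norm, Real.coe_toNNReal _ sys.L₂_pos.le]
      exact sys.lipschitz_own i x hx y hy yG hyD
  exact h2.comp h1 fun t ht => (hχ.2 t ht).1

/-- For every reference trajectory and every `w` there is a law with property (P) that steers
agent `i` to `χ δt + δt • w`, whatever laws the other agents use. -/
theorem exists_tracking_law (hSD : ∀ l, S l ⊆ sys.D)
    (hSd : ∀ l, ∀ x ∈ S l, ∀ y ∈ S l, ‖x - y‖ ≤ d)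
    (hδt : 0 < δt) (hlam : 0 ≤ lam) (hd : 0 ≤ d)
    (hq : sys.M * sys.L * δt ^ 2 - (1 - lam) * sys.vmax * δt + d ≤ 0) (hxG : xG ∈ S li.1)
    (hyG : ∀ j, yG j ∈ S (li.2 j)) {χ : ℝ → Space n}
    (hχ : sys.IsReferenceTrajectory δt i xG yG χ) (W : Set (Space n)) {wi : Space n}
    (hwi : ‖wi‖ ≤ lam * sys.vmax) :
    ∃ Ki : sys.FeedbackLaw i, sys.PropertyP S δt W i li Ki ∧
      ∀ l : Fin N → I, sys.pr i l = li →
      ∀ K : (m : Fin N) → sys.FeedbackLaw m, K i = Ki →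
        (∀ m, sys.PropertyP S δt W m (sys.pr m l) (K m)) →
      ∀ w : Fin N → Space n, w i = wi → (∀ m, w m ∈ W) →
      ∀ x₀ : Fin N → Space n, (∀ m, x₀ m ∈ S (l m)) →
      ∀ x, sys.IsClosedLoopSolution δt K w x₀ x → x i δt = χ δt + δt • wi := by
  have hyD : ∀ j, yG j ∈ sys.D := fun j => hSD _ (hyG j)
  obtain ⟨φ, hφ, hφχ⟩ := (hχ.lipschitzOnWith hyD).extend_finite_dimension
  refine ⟨saturatedLaw i fun x₀ w t x y => φ t - sys.f i x y + (δt⁻¹ • (xG - x₀) + w),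
    saturatedLaw_propertyP _ _ _ _ _ fun x₀ w => ?_, ?_⟩
  · obtain ⟨C, hC⟩ := sys.lipschitzOnWith_f_time i
    exact ⟨_, (((hφ.comp LipschitzWith.prod_fst).lipschitzOnWith.sub hC).add
      (LipschitzWith.const (δt⁻¹ • (xG - x₀) + w)).lipschitzOnWith)⟩
  intro l hl K hK hP w hw hwmem x₀ hx₀ x hx
  subst hl
  have hM := sys.M_pos
  have hv := sys.vmax_pos
  have hL₁ := sys.L₁_pos
  have hL₂ := sys.L₂_pos
  have hR : 0 ≤ sys.Rmax δt := by rw [Rmax]; positivity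
  set β : Space n := δt⁻¹ • (xG - x₀ i) with hβ
  have hβd : ‖xG - x₀ i‖ ≤ d := hSd _ _ hxG _ (hx₀ i)
  have hβn : ‖β‖ ≤ δt⁻¹ * d := by
    rw [hβ, norm_smul, Real.norm_of_nonneg (by positivity)]
    gcongr
  -- Deviation from the path that the unsaturated law would produce; its derivative is the
  -- saturation error.
  set e : ℝ → Space n := fun t => x i t - (χ t + ((x₀ i - xG) + t • (β + wi))) with he
  set ψ : ℝ → Space n := fun t =>
    sys.f i (χ t) yG - sys.f i (x i t) (fun j => x j t) + (β + wi) with hψ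
  have hder : ∀ t ∈ Icc 0 δt,
      HasDerivWithinAt e (saturate sys.vmax (ψ t) - ψ t) (Icc 0 δt) t := fun t ht => by
    have h1 := ((hx i).2 t ht).2.2
    rw [hK] at h1
    simp only [saturatedLaw, hw] at h1
    rw [← hφχ ht] at h1
    have h2 : HasDerivWithinAt (fun t : ℝ => (x₀ i - xG) + t • (β + wi)) (β + wi)
        (Icc 0 δt) t := by
      simpa using ((hasDerivWithinAt_id t (Icc 0 δt)).smul_const (β + wi)).const_add (x₀ i - xG)
    have h3 := h1.sub (((hχ.2 t ht).2).add h2)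
    refine h3.congr_deriv ?_
    simp only [hψ, hβ]
    abel
  have hbound : ∀ t ∈ Ico 0 δt, ‖saturate sys.vmax (ψ t) - ψ t‖ ≤ sys.L₂ * ‖e t‖ := fun t ht => by
    have htI := Ico_subset_Icc_self ht
    refine norm_saturate_sub_le hv (by positivity) ?_
    have hD : ∀ m, x m t ∈ sys.D := fun m => ((hx m).2 t htI).1
    have h1 : ‖sys.f i (χ t) yG - sys.f i (x i t) (fun j => x j t)‖ ≤
        sys.L₂ * ‖χ t - x i t‖ + sys.L₁ * √((sys.nbr i).card : ℝ) * (d + sys.Rmax δt) := by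
      refine sys.norm_f_sub_f_le (hχ.2 t htI).1 (hD i) hyD (fun j => hD j) (by positivity)
        fun j => (norm_sub_le_norm_sub_add_norm_sub (yG j) (x₀ j) (x j t)).trans
          (add_le_add (hSd _ _ (hyG j) _ (hx₀ j)) ?_)
      rw [norm_sub_rev]
      exact hx.norm_sub_le hP hwmem hx₀ ht j
    -- The initial offset enters with the factor `1 - t/δt ∈ [0, 1]`, hence costs at most `d`.
    have h2 : ‖χ t - x i t‖ ≤ ‖e t‖ + (d + δt * (lam * sys.vmax)) := by
      have hdec : χ t - x i t = -e t + ((1 - t * δt⁻¹) • (xG - x₀ i) + -(t • wi)) := by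
        simp only [he, hβ, sub_smul, one_smul, smul_add, smul_smul]
        abel
      rw [hdec]
      refine norm_add_le_of_le (norm_neg _).le (norm_add_le_of_le ?_ ?_)
      · have h3 : t * δt⁻¹ ≤ 1 := by
          rw [← div_eq_mul_inv]; exact (div_le_one hδt).2 htI.2
        have h4 : 0 ≤ t * δt⁻¹ := mul_nonneg ht.1 (by positivity)
        rw [norm_smul, Real.norm_of_nonneg (by linarith)]
        exact (mul_le_of_le_one_left (norm_nonneg _) (by linarith)).trans hβd
      · rw [norm_neg, norm_smul, Real.norm_of_nonneg ht.1]
        exact mul_le_mul htI.2 hwi (norm_nonneg _) hδt.le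
    obtain ⟨hb1, hb2⟩ := bounds_of_quadratic_nonpos hδt i hq
    have h5 : ‖ψ t‖ ≤ (sys.L₂ * (‖e t‖ + (d + δt * (lam * sys.vmax))) +
        sys.L₁ * √((sys.nbr i).card : ℝ) * (d + sys.Rmax δt)) +
          (δt⁻¹ * d + lam * sys.vmax) := by
      refine norm_add_le_of_le (h1.trans ?_) (norm_add_le_of_le hβn hwi)
      gcongr
    have h6 : sys.vmax * δt ≤ sys.M * δt :=
      mul_le_mul_of_nonneg_right sys.vmax_lt_M.le hδt.le
    have h7 : sys.L₂ * (d + δt * (lam * sys.vmax)) ≤ sys.L₂ * (sys.M * δt) :=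
      mul_le_mul_of_nonneg_left (by linarith) hL₂.le
    have h0 : 0 ≤ lam * sys.vmax * δt := by positivity
    have h00 : 0 ≤ sys.M * δt := by positivity
    have h8 : sys.L₁ * √((sys.nbr i).card : ℝ) * (d + sys.Rmax δt) ≤
        sys.L₁ * √((sys.nbr i).card : ℝ) * (4 * (sys.M * δt)) :=
      mul_le_mul_of_nonneg_left (by rw [Rmax]; linarith) (by positivity)
    have h9 : 0 ≤ sys.L₂ * (sys.M * δt) := by positivity
    linarith
  have he0 : e 0 = 0 := by
    simp only [he]
    rw [(hx i).1, hχ.1, zero_smul]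
    abel
  -- Grönwall from `e 0 = 0`: the saturation was never active.
  have hzero := eq_zero_of_abs_deriv_le_mul_abs_self_of_eq_zero_right
    (fun t ht => (hder t ht).continuousWithinAt)
    (fun t ht => (hder t (Ico_subset_Icc_self ht)).mono_of_mem_nhdsWithin
      (Icc_mem_nhdsGE_of_mem ht)) he0 hbound δt (right_mem_Icc.2 hδt.le)
  simp only [he, hβ, smul_add, smul_smul, mul_inv_cancel₀ hδt.ne', one_smul] at hzero
  rw [sub_eq_zero.1 hzero]
  abel

/-- Every point `χ δt + δt • w` lies in `D`, and the transitions to the cells that contain it are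
well posed. -/
theorem mem_and_wellPosedTransition (hIA : sys.InvarianceAssumption) (hSD : ∀ l, S l ⊆ sys.D)
    (hSd : ∀ l, ∀ x ∈ S l, ∀ y ∈ S l, ‖x - y‖ ≤ d)
    (hδt : 0 < δt) (hlam : 0 ≤ lam) (hd : 0 ≤ d)
    (hq : sys.M * sys.L * δt ^ 2 - (1 - lam) * sys.vmax * δt + d ≤ 0) (hxG : xG ∈ S li.1)
    (hyG : ∀ j, yG j ∈ S (li.2 j)) {χ : ℝ → Space n}
    (hχ : sys.IsReferenceTrajectory δt i xG yG χ) {z : Space n}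
    (hz : z ∈ Metric.closedBall (χ δt) (lam * sys.vmax * δt)) :
    z ∈ sys.D ∧ ∀ l', z ∈ S l' → sys.WellPosedTransition S δt
      (Metric.closedBall 0 (lam * sys.vmax)) i li l' := by
  set W : Set (Space n) := Metric.closedBall 0 (lam * sys.vmax) with hW
  set wi : Space n := δt⁻¹ • (z - χ δt) with hwi
  have hwn : ‖wi‖ ≤ lam * sys.vmax := by
    rw [hwi, norm_smul, Real.norm_of_nonneg (by positivity), inv_mul_le_iff₀ hδt, mul_comm]
    rwa [mem_closedBall_iff_norm] at hz
  have hwW : wi ∈ W := by simpa [hW] using hwn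
  have hzw : χ δt + δt • wi = z := by
    rw [hwi, smul_smul, mul_inv_cancel₀ hδt.ne', one_smul, add_sub_cancel]
  obtain ⟨Ki, hKi, hend⟩ :=
    exists_tracking_law hSD hSd hδt hlam hd hq hxG hyG hχ W hwn
  rw [hzw] at hend
  refine ⟨?_, fun l' hl' => ⟨Ki, hKi, wi, hwW, ?_⟩⟩
  -- To see `z ∈ D`, realize it as the endpoint of one closed-loop solution, with zero inputs for
  -- all other agents.
  · set l := extendConfig i li.1 li.2 with hl
    have hpr : sys.pr i l = li := pr_extendConfig i li
    have hP := soloLaw_propertyP (l := l) (by rwa [hpr] : sys.PropertyP S δt W i _ Ki)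
    obtain ⟨x, hx, -⟩ := exists_closedLoopSolution hIA hSD hδt hP (w := fun _ => wi)
      (fun _ => hwW) (extendConfig_mem hxG hyG)
    rw [← hend l hpr _ (by simp [soloLaw]) hP _ rfl (fun _ => hwW) _
      (extendConfig_mem hxG hyG) x hx]
    exact ((hx i).2 δt (right_mem_Icc.2 hδt.le)).1
  · intro l hl K hK hP w hw hwm x₀ hx₀
    have hP' : ∀ m, sys.PropertyP S δt W m (sys.pr m l) (K m) := fun m => by
      rcases eq_or_ne m i with rfl | h
      · rwa [hl, hK]
      · exact hP m h
    have hw' : ∀ m, w m ∈ W := fun m => by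
      rcases eq_or_ne m i with rfl | h
      · rwa [hw]
      · exact hwm m h
    obtain ⟨x, hx, -⟩ := exists_closedLoopSolution hIA hSD hδt hP' hw' hx₀
    exact ⟨⟨x, hx⟩, fun x hx => by rwa [hend l hl K hK hP' w hw hw' x₀ hx₀ x hx]⟩

end Parameters

end MultiAgentSystem

/-! ### The main theorem -/

theorem mainTheorem1 {N n : ℕ} (sys : MultiAgentSystem N n) (hIA : sys.InvarianceAssumption)
    {I : Type*} [Countable I] (S : I → Set (Space n)) (hS : IsCellDecomposition sys.D S)
    (δt lam mu : ℝ) (hδt : 0 < δt) (hlam : lam ∈ Ioo (0 : ℝ) 1) (hmu : 0 < mu)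
    (hadm : AdmissibleParameters sys.M sys.vmax sys.L lam mu (cellDiameter S) δt)
    (W : Set (Space n)) (hW : W = Metric.closedBall 0 (lam * sys.vmax))
    (r : ℝ) (hr : r = lam * sys.vmax * δt) :
    sys.WellPosedDiscretization S δt W ∧
    ∀ (i : Fin N) (li : sys.CellConfig I i),
      ((sys.individualTS S δt W i).Post li.1 li).Nonempty ∧
      ∀ xG ∈ S li.1, ∀ yG : sys.nbr i → Space n, (∀ j, yG j ∈ S (li.2 j)) →
        (∃ χ, sys.IsReferenceTrajectory δt i xG yG χ) ∧
        ∀ χ, sys.IsReferenceTrajectory δt i xG yG χ →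
          Metric.closedBall (χ δt) r ⊆ sys.D ∧
          {l : I | (S l ∩ Metric.closedBall (χ δt) r).Nonempty} ⊆
            (sys.individualTS S δt W i).Post li.1 li := by
  subst hW hr
  have hv := sys.vmax_pos
  have hlam0 := hlam.1
  have hSD : ∀ l, S l ⊆ sys.D := fun l => hS.iUnion_eq ▸ subset_iUnion S l
  have hSne : ∀ l, (S l).Nonempty := fun l => (hS.isConnected l).nonempty
  have hSd : ∀ l, ∀ x ∈ S l, ∀ y ∈ S l, ‖x - y‖ ≤ cellDiameter S :=
    fun l x hx y hy => norm_sub_le_cellDiameter hS hx hy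
  have hd : 0 ≤ cellDiameter S := Real.iSup_nonneg fun l => Metric.diam_nonneg
  -- An agent is needed for `L > 0`: the supremum over an empty family is 0.
  have hq : ∀ _ : Fin N, sys.M * sys.L * δt ^ 2 - (1 - lam) * sys.vmax * δt + cellDiameter S ≤ 0 :=
    fun i => hadm.quadratic_nonpos sys.M_pos hv (sys.L_pos i) hlam0 hmu
  have hex : ∀ (i : Fin N) (li : sys.CellConfig I i), ∀ xG ∈ S li.1,
      ∀ yG : sys.nbr i → Space n, (∀ j, yG j ∈ S (li.2 j)) →
      ∃ χ, sys.IsReferenceTrajectory δt i xG yG χ := fun i li xG hxG yG hyG =>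
    sys.exists_referenceTrajectory hIA hSD hδt hlam0.le hd (hq i) hxG hyG
  have hwell : ∀ (i : Fin N) (li : sys.CellConfig I i), ∃ l' : I,
      sys.WellPosedTransition S δt (Metric.closedBall 0 (lam * sys.vmax)) i li l' := by
    intro i li
    obtain ⟨xG, hxG⟩ := hSne li.1
    choose yG hyG using fun j => hSne (li.2 j)
    obtain ⟨χ, hχ⟩ := hex i li xG hxG yG hyG
    obtain ⟨hD, h⟩ := sys.mem_and_wellPosedTransition hIA hSD hSd hδt hlam0.le hd (hq i)
      hxG hyG hχ (Metric.mem_closedBall_self (by positivity))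
    rw [← hS.iUnion_eq, mem_iUnion] at hD
    obtain ⟨l', hl'⟩ := hD
    exact ⟨l', h l' hl'⟩
  refine ⟨hwell, fun i li => ⟨?_, fun xG hxG yG hyG => ⟨hex i li xG hxG yG hyG, fun χ hχ =>
    ⟨fun z hz => ?_, ?_⟩⟩⟩⟩
  · obtain ⟨l', hl'⟩ := hwell i li
    exact ⟨l', rfl, hl'⟩
  · exact (sys.mem_and_wellPosedTransition hIA hSD hSd hδt hlam0.le hd (hq i) hxG hyG hχ hz).1
  · rintro l' ⟨z, hzl, hz⟩
    exact ⟨rfl, (sys.mem_and_wellPosedTransition hIA hSD hSd hδt hlam0.le hd (hq i) hxG hyG hχ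
      hz).2 l' hzl⟩
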